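/- Let $E$ be a (real) Banach lattice with norm dual $E'$, ordered by $f\le g$ iff $f(x)\le g(x)$ for all $x\ge 0$ in $E$. A sequence $(x_n)$ in $E$ is called $uaw$-null (unbounded absolutely weakly null) if $|x_n|\wedge u\to 0$ weakly for every $u\in E$ with $u\ge 0$. For a Banach space $X$, a continuous linear operator $T:E\to X$ is called unbounded continuous if for every norm bounded $uaw$-null sequence $(x_n)$ in $E$, the sequence $(T(x_n))$ converges weakly to $0$ in $X$. The norm of $E'$ is order continuous (briefly, $E'$ is order continuous) if $f_\alpha\downarrow 0$ in $E'$ implies $\|f_\alpha\|\downarrow 0$. The following assertions are equivalent. (i) $E'$ is order continuous. (ii) Every continuous linear operator $T:E\to\ell_\infty$ is unbounded continuous. -/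

import Mathlib

open Filter Topology
open scoped ENNReal

/-- A family `x` in a Banach space converges to `a` in the weak topology along the filter `l`. -/
def WeaklyTendsto {X ι : Type*} [NormedAddCommGroup X] [NormedSpace ℝ X]
    (x : ι → X) (l : Filter ι) (a : X) : Prop :=
  Tendsto (fun i => toWeakSpace ℝ X (x i)) l (𝓝 (toWeakSpace ℝ X a))

/-- Weak convergence is convergence against every continuous linear functional. -/
theorem weaklyTendsto_iff {X ι : Type*} [NormedAddCommGroup X] [NormedSpace ℝ X]
    (x : ι → X) (l : Filter ι) (a : X) :
    WeaklyTendsto x l a ↔ ∀ f : StrongDual ℝ X, Tendsto (fun i => f (x i)) l (𝓝 (f a)) :=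
  WeakBilin.tendsto_iff_forall_eval_tendsto (topDualPairing ℝ X).flip fun _ _ h =>
    SeparatingDual.eq_iff_forall_dual_eq.mpr fun f => LinearMap.congr_fun h f

/-- Unbounded absolute weak (`uaw`) convergence of `x` to `a` along `l`:
`|x i - a| ⊓ u` converges weakly to `0` for every `u ≥ 0`. -/
def UAWTendsto {E ι : Type*} [NormedAddCommGroup E] [NormedSpace ℝ E] [Lattice E]
    (x : ι → E) (l : Filter ι) (a : E) : Prop :=
  ∀ u : E, 0 ≤ u → WeaklyTendsto (fun i => |x i - a| ⊓ u) l 0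

/-- A continuous operator from a Banach lattice to a Banach space is unbounded continuous if it
maps every norm bounded `uaw`-null sequence to a weakly null sequence. -/
def IsUnboundedContinuous {E X : Type*} [NormedAddCommGroup E] [NormedSpace ℝ E] [Lattice E]
    [NormedAddCommGroup X] [NormedSpace ℝ X] (T : E →L[ℝ] X) : Prop :=
  ∀ x : ℕ → E, Bornology.IsBounded (Set.range x) → UAWTendsto x atTop 0 →
    WeaklyTendsto (fun n => T (x n)) atTop 0

/-- The norm of an ordered normed space `F` is order continuous: `x_α ↓ 0` implies `‖x_α‖ ↓ 0`.
A decreasing net is given here by its set of values, a nonempty downward directed set. -/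
def HasOrderContinuousNorm (F : Type*) [NormedAddCommGroup F] [PartialOrder F] : Prop :=
  ∀ D : Set F, D.Nonempty → DirectedOn (· ≥ ·) D → IsGLB D 0 →
    IsGLB ((fun f : F => ‖f‖) '' D) 0

/-- The norm dual `E'` of a Banach lattice `E`: continuous linear functionals with the operator
norm. It is a type of its own so that it can carry the dual order. -/
def LatticeDual (E : Type*) [NormedAddCommGroup E] [NormedSpace ℝ E] : Type _ :=
  StrongDual ℝ E

noncomputable instance (E : Type*) [NormedAddCommGroup E] [NormedSpace ℝ E] :
    NormedAddCommGroup (LatticeDual E) :=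
  inferInstanceAs (NormedAddCommGroup (StrongDual ℝ E))

noncomputable instance (E : Type*) [NormedAddCommGroup E] [NormedSpace ℝ E] :
    NormedSpace ℝ (LatticeDual E) :=
  inferInstanceAs (NormedSpace ℝ (StrongDual ℝ E))

instance (E : Type*) [NormedAddCommGroup E] [NormedSpace ℝ E] :
    FunLike (LatticeDual E) E ℝ :=
  inferInstanceAs (FunLike (StrongDual ℝ E) E ℝ)

/-- The dual order: `f ≤ g` if and only if `f x ≤ g x` for all `x ≥ 0`. -/
instance (E : Type*) [NormedAddCommGroup E] [NormedSpace ℝ E] [Lattice E]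
    [IsOrderedAddMonoid E] : PartialOrder (LatticeDual E) where
  le f g := ∀ x : E, 0 ≤ x → f x ≤ g x
  le_refl _ _ _ := le_rfl
  le_trans _ _ _ hfg hgh x hx := (hfg x hx).trans (hgh x hx)
  le_antisymm f g hfg hgf := by
    have h : ∀ x : E, 0 ≤ x → f x = g x := fun x hx => le_antisymm (hfg x hx) (hgf x hx)
    refine DFunLike.ext f g fun x => ?_
    have hf : f x = f x⁺ - f x⁻ := by
      conv_lhs => rw [← posPart_sub_negPart x]
      exact map_sub (show StrongDual ℝ E from f) _ _
    have hg : g x = g x⁺ - g x⁻ := by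
      conv_lhs => rw [← posPart_sub_negPart x]
      exact map_sub (show StrongDual ℝ E from g) _ _
    rw [hf, hg, h _ (posPart_nonneg x), h _ (negPart_nonneg x)]

/-! Only one nonzero vector of the target matters: both assertions say that bounded disjoint
positive sequences in `E` are weakly null. Such sequences are always `uaw`-null, since disjoint
sequences in an order interval are weakly null; rank-one operators then give this property from
(ii).

The bridge is `exists_disjoint_sequence`: if no order interval almost carries a positive functional
`F` uniformly on a ball, `F` is bounded below on a bounded disjoint sequence. A bounded `uaw`-null
sequence that is not weakly null yields such an `F`, and so does a net in `E'` decreasing to `0`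
with norms bounded below.

Order continuity of `E'` excludes these disjoint sequences
(`HasOrderContinuousNorm.not_forall_le_of_disjoint`): the parts of `F` carried by the terms form a
pointwise convergent series whose tails decrease to `0`, but not in norm. -/

section BanachLattice

variable {E : Type*} [NormedAddCommGroup E] [Lattice E] [IsOrderedAddMonoid E]

/-! ### Disjointness and lattice estimates -/

theorem inf_add_le_add_inf {a b c : E} (ha : 0 ≤ a) (hb : 0 ≤ b) (hc : 0 ≤ c) :
    a ⊓ (b + c) ≤ a ⊓ b + a ⊓ c := by
  rw [add_inf, inf_add, inf_add]
  refine le_inf (le_inf ?_ ?_) (le_inf ?_ ?_)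
  · exact inf_le_left.trans (le_add_of_nonneg_right ha)
  · exact inf_le_left.trans (le_add_of_nonneg_left hb)
  · exact inf_le_left.trans (le_add_of_nonneg_right hc)
  · exact inf_le_right

theorem inf_add_eq_zero {a b c : E} (ha : 0 ≤ a) (hb : 0 ≤ b) (hc : 0 ≤ c)
    (hab : a ⊓ b = 0) (hac : a ⊓ c = 0) : a ⊓ (b + c) = 0 :=
  le_antisymm (by simpa [hab, hac] using inf_add_le_add_inf ha hb hc)
    (le_inf ha (add_nonneg hb hc))

theorem inf_nsmul_eq_zero {a b : E} (ha : 0 ≤ a) (hb : 0 ≤ b) (hab : a ⊓ b = 0) (k : ℕ) :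
    a ⊓ (k • b) = 0 := by
  induction k with
  | zero => simpa using ha
  | succ k ih =>
    rw [succ_nsmul]
    exact inf_add_eq_zero ha (nsmul_nonneg hb k) hb ih hab

/-- A finite sum of pairwise disjoint elements of `[0, u]` is at most `u`. -/
theorem sum_le_of_pairwise_inf_eq_zero {u : E} (hu : 0 ≤ u) {z : ℕ → E} (hz : ∀ n, 0 ≤ z n)
    (hzu : ∀ n, z n ≤ u) (hd : Pairwise fun m n => z m ⊓ z n = 0) (s : Finset ℕ) :
    ∑ i ∈ s, z i ≤ u ∧ ∀ j ∉ s, z j ⊓ ∑ i ∈ s, z i = 0 := by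
  induction s using Finset.induction_on with
  | empty => exact ⟨by simpa using hu, fun j _ => by simpa using hz j⟩
  | insert a s ha ih =>
    have hs : 0 ≤ ∑ i ∈ s, z i := Finset.sum_nonneg fun i _ => hz i
    rw [Finset.sum_insert ha]
    refine ⟨?_, fun j hj => ?_⟩
    · have h := inf_add_sup (z a) (∑ i ∈ s, z i)
      rw [ih.2 a ha, zero_add] at h
      exact h ▸ sup_le (hzu a) ih.1
    · rw [Finset.mem_insert, not_or] at hj
      exact inf_add_eq_zero (hz j) (hz a) hs (hd hj.1) (ih.2 j hj.2)

theorem norm_le_norm_of_nonneg_of_le [HasSolidNorm E] {a b : E} (ha : 0 ≤ a) (hab : a ≤ b) :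
    ‖a‖ ≤ ‖b‖ :=
  norm_le_norm_of_abs_le_abs (by rwa [abs_of_nonneg ha, abs_of_nonneg (ha.trans hab)])

theorem norm_posPart_le [HasSolidNorm E] (a : E) : ‖a⁺‖ ≤ ‖a‖ :=
  norm_le_norm_of_abs_le_abs (by
    rw [abs_of_nonneg (posPart_nonneg a)]; exact sup_le (le_abs_self a) (abs_nonneg a))

theorem norm_negPart_le [HasSolidNorm E] (a : E) : ‖a⁻‖ ≤ ‖a‖ := by
  simpa using norm_posPart_le (-a)

theorem posPart_sub_eq_sub_inf (a b : E) : (a - b)⁺ = a - a ⊓ b := by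
  rw [posPart_def, sub_eq_add_neg a (a ⊓ b), neg_inf, add_sup]
  simp [sub_eq_add_neg, sup_comm]

variable [NormedSpace ℝ E]

/-! ### Positive functionals -/

/-- A positive additive bounded function on the positive cone extends to a continuous linear
functional. -/
theorem exists_strongDual_eq_on_nonneg [HasSolidNorm E] (p : E → ℝ) (C : ℝ)
    (hadd : ∀ x y, 0 ≤ x → 0 ≤ y → p (x + y) = p x + p y)
    (h0 : ∀ x, 0 ≤ x → 0 ≤ p x) (hC : ∀ x, 0 ≤ x → p x ≤ C * ‖x‖) (hC0 : 0 ≤ C) :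
    ∃ g : StrongDual ℝ E, ∀ x, 0 ≤ x → g x = p x := by
  have hp0 : p 0 = 0 := by simpa using hadd 0 0 le_rfl le_rfl
  let g₀ : E →+ ℝ := AddMonoidHom.mk' (fun x => p x⁺ - p x⁻) (by
    intro x y
    have h : (x + y)⁺ + (x⁻ + y⁻) = (x + y)⁻ + (x⁺ + y⁺) := by
      have h1 := posPart_sub_negPart (x + y)
      have h2 : (x + y)⁺ - (x + y)⁻ = (x⁺ - x⁻) + (y⁺ - y⁻) := by
        rw [h1, posPart_sub_negPart, posPart_sub_negPart]
      rw [← sub_eq_zero] at h2 ⊢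
      rw [← h2]; abel
    have hx := posPart_nonneg x
    have hx' := negPart_nonneg x
    have hy := posPart_nonneg y
    have hy' := negPart_nonneg y
    have h' := congrArg p h
    rw [hadd _ _ (posPart_nonneg _) (add_nonneg hx' hy'), hadd _ _ hx' hy',
      hadd _ _ (negPart_nonneg _) (add_nonneg hx hy), hadd _ _ hx hy] at h'
    linarith)
  have hg : ∀ x, ‖g₀ x‖ ≤ C * ‖x‖ := by
    intro x
    have h1 := h0 _ (posPart_nonneg x)
    have h2 := h0 _ (negPart_nonneg x)
    have h3 := (hC _ (posPart_nonneg x)).trans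
      (mul_le_mul_of_nonneg_left (norm_posPart_le x) hC0)
    have h4 := (hC _ (negPart_nonneg x)).trans
      (mul_le_mul_of_nonneg_left (norm_negPart_le x) hC0)
    change |p x⁺ - p x⁻| ≤ _
    rw [abs_le]
    constructor <;> linarith
  refine ⟨g₀.toRealLinearMap (AddMonoidHomClass.continuous_of_bound g₀ C hg), fun x hx => ?_⟩
  change p x⁺ - p x⁻ = p x
  rw [posPart_eq_self.2 hx, negPart_eq_zero.2 hx, hp0, sub_zero]

/-- Positive functionals are monotone. -/
theorem StrongDual.mono_of_nonneg {F : StrongDual ℝ E} (hF : ∀ x, 0 ≤ x → 0 ≤ F x) {x y : E}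
    (h : x ≤ y) : F x ≤ F y := by
  have := hF (y - x) (sub_nonneg.2 h)
  rw [map_sub] at this
  linarith

theorem StrongDual.apply_le_norm_mul {X : Type*} [NormedAddCommGroup X] [NormedSpace ℝ X]
    (F : StrongDual ℝ X) (x : X) : F x ≤ ‖F‖ * ‖x‖ :=
  (le_abs_self _).trans (F.le_opNorm x)

theorem StrongDual.abs_apply_le_of_nonneg {F : StrongDual ℝ E} (hF : ∀ x, 0 ≤ x → 0 ≤ F x)
    (x : E) : |F x| ≤ F |x| := by
  rw [abs_le]
  constructor
  · have := mono_of_nonneg hF (neg_le_abs x)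
    rw [map_neg] at this
    linarith
  · exact mono_of_nonneg hF (le_abs_self x)

/-- Every continuous linear functional is a difference of two positive ones. -/
theorem StrongDual.exists_nonneg_sub_nonneg [HasSolidNorm E] (f : StrongDual ℝ E) :
    ∃ F G : StrongDual ℝ E, (∀ x, 0 ≤ x → 0 ≤ F x) ∧ (∀ x, 0 ≤ x → 0 ≤ G x) ∧ f = F - G := by
  -- Riesz–Kantorovich formula: the supremum of `f` over `[0, x]` is the positive part of `f` at
  -- `x`.
  let S : E → Set ℝ := fun x => f '' Set.Icc 0 x
  have hmem : ∀ x, 0 ≤ x → f x ∈ S x := fun x hx => ⟨x, ⟨hx, le_rfl⟩, rfl⟩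
  have hmem0 : ∀ x, 0 ≤ x → 0 ∈ S x := fun x hx => ⟨0, ⟨le_rfl, hx⟩, map_zero f⟩
  have hbound : ∀ x, ∀ r ∈ S x, r ≤ ‖f‖ * ‖x‖ := by
    rintro x _ ⟨a, ha, rfl⟩
    exact (apply_le_norm_mul f a).trans
      (mul_le_mul_of_nonneg_left (norm_le_norm_of_nonneg_of_le ha.1 ha.2) (norm_nonneg f))
  have hbdd : ∀ x, BddAbove (S x) := fun x => ⟨_, fun r hr => hbound x r hr⟩
  obtain ⟨F, hF⟩ := exists_strongDual_eq_on_nonneg (fun x => sSup (S x)) ‖f‖ (by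
      intro x y hx hy
      apply le_antisymm
      · refine csSup_le ⟨_, hmem0 _ (add_nonneg hx hy)⟩ ?_
        rintro _ ⟨a, ha, rfl⟩
        -- Riesz decomposition: `a ≤ x + y` splits into `a ⊓ x ≤ x` and `a - a ⊓ x = (a - x)⁺ ≤ y`.
        have h1 : f (a ⊓ x) ≤ sSup (S x) :=
          le_csSup (hbdd x) ⟨_, ⟨le_inf ha.1 hx, inf_le_right⟩, rfl⟩
        have h2 : f (a - a ⊓ x) ≤ sSup (S y) := by
          refine le_csSup (hbdd y) ⟨_, ⟨sub_nonneg.2 inf_le_left, ?_⟩, rfl⟩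
          rw [← posPart_sub_eq_sub_inf]
          exact sup_le (by rw [sub_le_iff_le_add']; exact ha.2) hy
        rw [map_sub] at h2
        linarith
      · rw [← le_sub_iff_add_le]
        refine csSup_le ⟨_, hmem0 _ hx⟩ ?_
        rintro _ ⟨a, ha, rfl⟩
        rw [le_sub_comm]
        refine csSup_le ⟨_, hmem0 _ hy⟩ ?_
        rintro _ ⟨b, hb, rfl⟩
        rw [le_sub_iff_add_le', ← map_add]
        exact le_csSup (hbdd _) ⟨_, ⟨add_nonneg ha.1 hb.1, add_le_add ha.2 hb.2⟩, rfl⟩)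
    (fun x hx => le_csSup (hbdd x) (hmem0 x hx))
    (fun x hx => csSup_le ⟨_, hmem0 _ hx⟩ (hbound x)) (norm_nonneg f)
  refine ⟨F, F - f, fun x hx => ?_, fun x hx => ?_, by abel⟩
  · rw [hF x hx]
    exact le_csSup (hbdd x) (hmem0 x hx)
  · rw [_root_.sub_apply, hF x hx, sub_nonneg]
    exact le_csSup (hbdd x) (hmem x hx)

/-! ### Disjoint sequences -/

/-- Order bounded disjoint sequences of positive elements are weakly null. -/
theorem weaklyTendsto_zero_of_pairwise_inf_eq_zero [HasSolidNorm E] {u : E} (hu : 0 ≤ u)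
    {z : ℕ → E} (hz : ∀ n, 0 ≤ z n) (hzu : ∀ n, z n ≤ u)
    (hd : Pairwise fun m n => z m ⊓ z n = 0) : WeaklyTendsto z atTop 0 := by
  rw [weaklyTendsto_iff]
  intro f
  rw [map_zero]
  obtain ⟨F, G, hF, hG, rfl⟩ := StrongDual.exists_nonneg_sub_nonneg f
  have key : ∀ H : StrongDual ℝ E, (∀ x, 0 ≤ x → 0 ≤ H x) →
      Tendsto (fun n => H (z n)) atTop (𝓝 0) := by
    intro H hH
    -- Finite sums of the `z n` stay below `u`, so the series of values is bounded by `H u`.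
    refine (summable_of_sum_le (c := H u) (fun n => hH _ (hz n)) fun s => ?_).tendsto_atTop_zero
    rw [← map_sum]
    exact StrongDual.mono_of_nonneg hH (sum_le_of_pairwise_inf_eq_zero hu hz hzu hd s).1
  simpa using (key F hF).sub (key G hG)

theorem uawTendsto_zero_of_pairwise_inf_eq_zero [HasSolidNorm E] {y : ℕ → E}
    (hy : ∀ n, 0 ≤ y n) (hd : Pairwise fun m n => y m ⊓ y n = 0) : UAWTendsto y atTop 0 := by
  intro u hu
  have h : (fun i => |y i - 0| ⊓ u) = fun i => y i ⊓ u := by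
    funext i
    rw [sub_zero, abs_of_nonneg (hy i)]
  rw [h]
  refine weaklyTendsto_zero_of_pairwise_inf_eq_zero hu (fun n => le_inf (hy n) hu)
    (fun n => inf_le_right) fun m n hmn => ?_
  refine le_antisymm ?_ (le_inf (le_inf (hy m) hu) (le_inf (hy n) hu))
  rw [← hd hmn]
  exact inf_le_inf inf_le_left inf_le_left

/-- The two elements lie below `(x - K • y)⁺` and `(x - K • y)⁻`: the hypotheses on `b` give `x ≤ K
• b`, hence `K • (y - b) ≤ K • y - x`. -/
theorem posPart_inf_posPart_eq_zero [IsOrderedModule ℝ E] {x y a b : E} {K δ : ℝ} (hx : 0 ≤ x)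
    (hK : 1 ≤ K) (hδ : 1 ≤ K * δ) (ha : K • y ≤ a) (hb : δ • x ≤ b) :
    (x - a)⁺ ⊓ (y - b)⁺ = 0 := by
  have hK0 : 0 < K := zero_lt_one.trans_le hK
  refine le_antisymm ?_ (le_inf (posPart_nonneg _) (posPart_nonneg _))
  rw [← posPart_inf_negPart_eq_zero (x - K • y)]
  refine inf_le_inf (posPart_mono (sub_le_sub_left ha x)) (sup_le ?_ (negPart_nonneg _))
  set w := (x - K • y)⁻ with hw
  have hw0 : 0 ≤ w := negPart_nonneg _
  have h1 : K • y - x ≤ w := by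
    have := neg_le_negPart (x - K • y)
    rwa [neg_sub] at this
  have h2 : K • (y - b) ≤ w := by
    refine le_trans ?_ h1
    rw [smul_sub]
    refine sub_le_sub_left ?_ _
    calc x = (1 : ℝ) • x := (one_smul ℝ x).symm
      _ ≤ (K * δ) • x := smul_le_smul_of_nonneg_right hδ hx
      _ = K • δ • x := mul_smul _ _ _
      _ ≤ K • b := smul_le_smul_of_nonneg_left hb hK0.le
  calc y - b = K⁻¹ • K • (y - b) := by rw [smul_smul, inv_mul_cancel₀ hK0.ne', one_smul]
    _ ≤ K⁻¹ • w := smul_le_smul_of_nonneg_left h2 (inv_nonneg.2 hK0.le)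
    _ ≤ (1 : ℝ) • w := smul_le_smul_of_nonneg_right (inv_le_one_of_one_le₀ hK) hw0
    _ = w := one_smul ℝ w

/-- If a positive functional `F` is not almost concentrated on any order interval, uniformly on a
ball, then it stays away from zero along some bounded disjoint sequence of positive elements. -/
theorem exists_disjoint_sequence [CompleteSpace E] [IsOrderedModule ℝ E] [HasSolidNorm E]
    {F : StrongDual ℝ E} (hF : ∀ x, 0 ≤ x → 0 ≤ F x) {c C : ℝ} (hc : 0 < c)
    (h : ∀ w : E, 0 ≤ w → ∃ x : E, 0 ≤ x ∧ ‖x‖ ≤ C ∧ c ≤ F (x - w)⁺) :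
    ∃ y : ℕ → E, (∀ n, 0 ≤ y n) ∧ (∀ n, ‖y n‖ ≤ C) ∧ (Pairwise fun m n => y m ⊓ y n = 0) ∧
      ∀ n, c / 2 ≤ F (y n) := by
  choose! G hG0 hGC hGc using h
  -- `s n` is the sum of the earlier terms `x 0, …, x (n - 1)`; each new term is chosen against the
  -- multiple `4 ^ n • s n`.
  let s : ℕ → E := fun n => Nat.rec 0 (fun n t => t + G ((4 : ℝ) ^ n • t)) n
  let x : ℕ → E := fun n => G ((4 : ℝ) ^ n • s n)
  have hs : ∀ n, s (n + 1) = s n + x n := fun n => rfl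
  have hs0 : ∀ n, 0 ≤ s n := by
    intro n
    induction n with
    | zero => exact le_rfl
    | succ n ih => exact add_nonneg ih (hG0 _ (smul_nonneg (by positivity) ih))
  have hw0 : ∀ n, 0 ≤ (4 : ℝ) ^ n • s n := fun n => smul_nonneg (by positivity) (hs0 n)
  have hx0 : ∀ n, 0 ≤ x n := fun n => hG0 _ (hw0 n)
  have hsm : Monotone s := monotone_nat_of_le_succ fun n => by
    rw [hs]; exact le_add_of_nonneg_right (hx0 n)
  have hxs : ∀ m n, m < n → x m ≤ s n := fun m n hmn =>
    le_trans (by rw [hs]; exact le_add_of_nonneg_left (hs0 m)) (hsm hmn)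
  have hsum : Summable fun n => ((1 / 2 : ℝ) ^ n) • x n := by
    refine Summable.of_norm_bounded (g := fun n => (1 / 2 : ℝ) ^ n * C)
      (summable_geometric_two.mul_right C) fun n => ?_
    rw [norm_smul, norm_pow]
    norm_num
    exact hGC _ (hw0 n)
  have hterm : ∀ n, 0 ≤ ((1 / 2 : ℝ) ^ n) • x n := fun n => smul_nonneg (by positivity) (hx0 n)
  set u := ∑' n, ((1 / 2 : ℝ) ^ n) • x n with hu
  have hu0 : 0 ≤ u := tsum_nonneg hterm
  have hxu : ∀ n, ((1 / 2 : ℝ) ^ n) • x n ≤ u := fun n => hsum.le_tsum n fun j _ => hterm j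
  -- Removing `4 ^ n • s n` handles disjointness from earlier terms, removing the small multiple of
  -- `u` that from later ones.
  let y : ℕ → E := fun n => (x n - ((4 : ℝ) ^ n • s n + (1 / 2 : ℝ) ^ n • u))⁺
  have hlt : ∀ m n, m < n → y n ⊓ y m = 0 := by
    intro m n hmn
    -- Here `K * δ = 2 ^ (n - m) ≥ 1`; this is why the powers of 4 are paired with powers of 1/2.
    refine posPart_inf_posPart_eq_zero (K := 4 ^ n) (δ := (1 / 2) ^ m * (1 / 2) ^ n) (hx0 n)
      (one_le_pow₀ (by norm_num)) ?_ ?_ ?_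
    · have : (4 : ℝ) ^ n = 2 ^ n * 2 ^ n := by rw [← mul_pow]; norm_num
      rw [this, one_div, inv_pow, inv_pow]
      have h2 : (2 : ℝ) ^ m ≤ 2 ^ n := pow_le_pow_right₀ (by norm_num) hmn.le
      have h3 : (0 : ℝ) < 2 ^ m := by positivity
      have h4 : (0 : ℝ) < 2 ^ n := by positivity
      calc (1 : ℝ) ≤ 2 ^ n / 2 ^ m := (one_le_div h3).2 h2
        _ = _ := by field_simp
    · exact (smul_le_smul_of_nonneg_left (hxs m n hmn) (by positivity)).trans
        (le_add_of_nonneg_right (smul_nonneg (by positivity) hu0))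
    · rw [mul_smul]
      exact (smul_le_smul_of_nonneg_left (hxu n) (by positivity)).trans
        (le_add_of_nonneg_left (hw0 m))
  have hyx : ∀ n, y n ≤ x n := fun n =>
    sup_le (sub_le_self _ (add_nonneg (hw0 n) (smul_nonneg (by positivity) hu0))) (hx0 n)
  have hFy : ∀ n, c - (1 / 2 : ℝ) ^ n * F u ≤ F (y n) := by
    intro n
    have h1 : (x n - (4 : ℝ) ^ n • s n)⁺ - (1 / 2 : ℝ) ^ n • u ≤ y n := by
      rw [sub_le_iff_le_add]
      refine sup_le ?_ (add_nonneg (posPart_nonneg _) (smul_nonneg (by positivity) hu0))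
      rw [← sub_le_iff_le_add, sub_sub]
      exact le_posPart _
    have h2 := StrongDual.mono_of_nonneg hF h1
    rw [map_sub, map_smul, smul_eq_mul] at h2
    have h3 : c ≤ F (x n - (4 : ℝ) ^ n • s n)⁺ := hGc _ (hw0 n)
    linarith
  have hlim : Tendsto (fun n : ℕ => (1 / 2 : ℝ) ^ n * F u) atTop (𝓝 0) := by
    simpa using (tendsto_pow_atTop_nhds_zero_of_lt_one (r := (1 / 2 : ℝ)) (by norm_num)
      (by norm_num)).mul_const (F u)
  -- Dropping finitely many terms makes the loss `(1 / 2) ^ n * F u` at most `c / 2`.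
  obtain ⟨N, hN⟩ := eventually_atTop.1 (hlim.eventually_le_const (half_pos hc))
  refine ⟨fun n => y (n + N), fun n => posPart_nonneg _, fun n => ?_, fun m n hmn => ?_,
    fun n => ?_⟩
  · exact (norm_le_norm_of_nonneg_of_le (posPart_nonneg _) (hyx _)).trans (hGC _ (hw0 _))
  · rcases lt_or_gt_of_ne hmn with h | h
    · change y (m + N) ⊓ y (n + N) = 0
      rw [inf_comm]
      exact hlt _ _ (by omega)
    · exact hlt _ _ (by omega)
  · have h1 := hN (n + N) (by omega)
    have h2 := hFy (n + N)
    linarith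

/-! ### Carried parts and order continuity of the dual norm -/

/-- The part of a positive functional `f` carried by the ideal generated by `v`, on the positive
cone. -/
noncomputable def carriedPart (f : StrongDual ℝ E) (v x : E) : ℝ :=
  ⨆ k : ℕ, f (x ⊓ k • v)

theorem bddAbove_carriedPart {f : StrongDual ℝ E} (hf : ∀ x, 0 ≤ x → 0 ≤ f x) (v x : E) :
    BddAbove (Set.range fun k : ℕ => f (x ⊓ k • v)) :=
  ⟨f x, by rintro _ ⟨k, rfl⟩; exact StrongDual.mono_of_nonneg hf inf_le_left⟩

theorem tendsto_carriedPart {f : StrongDual ℝ E} (hf : ∀ x, 0 ≤ x → 0 ≤ f x) {v : E}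
    (hv : 0 ≤ v) (x : E) :
    Tendsto (fun k : ℕ => f (x ⊓ k • v)) atTop (𝓝 (carriedPart f v x)) :=
  tendsto_atTop_ciSup (fun _ _ h => StrongDual.mono_of_nonneg hf
    (inf_le_inf_left x (nsmul_le_nsmul_left hv h))) (bddAbove_carriedPart hf v x)

theorem carriedPart_nonneg {f : StrongDual ℝ E} (hf : ∀ x, 0 ≤ x → 0 ≤ f x) {v x : E}
    (hv : 0 ≤ v) (hx : 0 ≤ x) : 0 ≤ carriedPart f v x :=
  ge_of_tendsto' (tendsto_carriedPart hf hv x) fun k => hf _ (le_inf hx (nsmul_nonneg hv k))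

theorem le_carriedPart_self {f : StrongDual ℝ E} (hf : ∀ x, 0 ≤ x → 0 ≤ f x) (v : E) :
    f v ≤ carriedPart f v v := by
  have h : f (v ⊓ 1 • v) ≤ carriedPart f v v := le_ciSup (bddAbove_carriedPart hf v v) 1
  rwa [one_nsmul, inf_idem] at h

theorem carriedPart_add {f : StrongDual ℝ E} (hf : ∀ x, 0 ≤ x → 0 ≤ f x) {v x y : E}
    (hv : 0 ≤ v) (hx : 0 ≤ x) (hy : 0 ≤ y) :
    carriedPart f v (x + y) = carriedPart f v x + carriedPart f v y := by
  have hlim := (tendsto_carriedPart hf hv x).add (tendsto_carriedPart hf hv y)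
  apply le_antisymm
  · refine le_of_tendsto_of_tendsto' (tendsto_carriedPart hf hv (x + y)) hlim fun k => ?_
    rw [← map_add]
    refine StrongDual.mono_of_nonneg hf ?_
    have := inf_add_le_add_inf (nsmul_nonneg hv k) hx hy
    rwa [inf_comm, inf_comm x, inf_comm y]
  · refine le_of_tendsto' hlim fun k => ?_
    -- Doubling the index leaves room for `x ⊓ k • v + y ⊓ k • v ≤ (x + y) ⊓ (k + k) • v`.
    refine le_trans ?_ (le_ciSup (bddAbove_carriedPart hf v (x + y)) (k + k))
    rw [← map_add]
    refine StrongDual.mono_of_nonneg hf (le_inf (add_le_add inf_le_left inf_le_left) ?_)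
    rw [add_nsmul]
    exact add_le_add inf_le_right inf_le_right

/-- For fixed `k` the elements `x ⊓ k • y j` are disjoint in `[0, x]`, so their sum is at most `x`;
then let `k` tend to infinity. -/
theorem sum_carriedPart_le {f : StrongDual ℝ E} (hf : ∀ x, 0 ≤ x → 0 ≤ f x) {y : ℕ → E}
    (hy : ∀ n, 0 ≤ y n) (hd : Pairwise fun m n => y m ⊓ y n = 0) {x : E} (hx : 0 ≤ x)
    (s : Finset ℕ) : ∑ j ∈ s, carriedPart f (y j) x ≤ f x := by
  refine le_of_tendsto' (tendsto_finsetSum s fun j _ => tendsto_carriedPart hf (hy j) x)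
    fun k => ?_
  rw [← map_sum]
  refine StrongDual.mono_of_nonneg hf (sum_le_of_pairwise_inf_eq_zero hx
    (z := fun j => x ⊓ k • y j) (fun j => le_inf hx (nsmul_nonneg (hy j) k))
    (fun j => inf_le_left) (fun m n hmn => ?_) s).1
  have hm := nsmul_nonneg (hy m) k
  have hn := nsmul_nonneg (hy n) k
  have h1 : y m ⊓ k • y n = 0 := inf_nsmul_eq_zero (hy m) (hy n) (hd hmn) k
  have h2 : k • y n ⊓ k • y m = 0 := inf_nsmul_eq_zero hn (hy m) (by rwa [inf_comm]) k
  refine le_antisymm ?_ (le_inf (le_inf hx hm) (le_inf hx hn))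
  rw [← h2, inf_comm]
  exact inf_le_inf inf_le_right inf_le_right

/-- If the dual norm is order continuous, positive functionals cannot stay away from zero along a
bounded disjoint sequence of positive elements. -/
theorem HasOrderContinuousNorm.not_forall_le_of_disjoint [HasSolidNorm E]
    (hE : HasOrderContinuousNorm (LatticeDual E)) {f : StrongDual ℝ E}
    (hf : ∀ x, 0 ≤ x → 0 ≤ f x) {y : ℕ → E} (hy : ∀ n, 0 ≤ y n) {C : ℝ}
    (hyC : ∀ n, ‖y n‖ ≤ C) (hd : Pairwise fun m n => y m ⊓ y n = 0) {c : ℝ} (hc : 0 < c) :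
    ¬ ∀ n, c ≤ f (y n) := by
  intro hfy
  let q : ℕ → E → ℝ := fun j x => carriedPart f (y j) x
  have hq0 : ∀ j x, 0 ≤ x → 0 ≤ q j x := fun j x hx => carriedPart_nonneg hf (hy j) hx
  have hqs : ∀ x, 0 ≤ x → Summable fun j => q j x := fun x hx =>
    summable_of_sum_le (fun j => hq0 j x hx) (sum_carriedPart_le hf hy hd hx)
  have hqsn : ∀ n x, 0 ≤ x → Summable fun j => q (j + n) x := fun n x hx =>
    (summable_nat_add_iff n).2 (hqs x hx)
  -- The tails of the series of carried parts are functionals; they decrease to `0` pointwise on the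
  -- cone, yet the `n`-th is at least `c` at `y n`.
  have hex : ∀ n : ℕ, ∃ g : StrongDual ℝ E, ∀ x, 0 ≤ x → g x = ∑' j, q (j + n) x := by
    intro n
    refine exists_strongDual_eq_on_nonneg _ ‖f‖ (fun x z hx hz => ?_)
      (fun x hx => tsum_nonneg fun j => hq0 _ x hx) (fun x hx => ?_) (norm_nonneg f)
    · rw [← (hqsn n x hx).tsum_add (hqsn n z hz)]
      exact tsum_congr fun j => carriedPart_add hf (hy _) hx hz
    · refine le_trans ?_ (StrongDual.apply_le_norm_mul f x)
      refine Real.tsum_le_of_sum_le (fun j => hq0 _ x hx) fun s => ?_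
      refine sum_carriedPart_le hf (y := fun j => y (j + n)) (fun j => hy _) ?_ hx s
      exact fun i j hij => hd (by simpa using hij)
  choose g hg using hex
  have hg0 : ∀ n x, 0 ≤ x → 0 ≤ g n x := fun n x hx => by
    rw [hg n x hx]; exact tsum_nonneg fun j => hq0 _ x hx
  have hgc : ∀ n, c ≤ g n (y n) := by
    intro n
    rw [hg n _ (hy n)]
    refine ((hfy n).trans (le_carriedPart_self hf (y n))).trans ?_
    simpa using (hqsn n (y n) (hy n)).le_tsum 0 fun j _ => hq0 _ _ (hy n)
  have hanti : ∀ m n, m ≤ n → ∀ x, 0 ≤ x → g n x ≤ g m x := by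
    intro m n hmn x hx
    rw [hg n x hx, hg m x hx]
    obtain ⟨k, rfl⟩ := Nat.exists_eq_add_of_le hmn
    have h := (hqsn m x hx).sum_add_tsum_nat_add k
    have h' : ∀ j, q (j + (m + k)) x = q (j + k + m) x := fun j => by
      congr 1; omega
    rw [tsum_congr h', ← h]
    exact le_add_of_nonneg_left (Finset.sum_nonneg fun j _ => hq0 _ x hx)
  let g' : ℕ → LatticeDual E := g
  have hglb : IsGLB ((fun φ : LatticeDual E => ‖φ‖) '' Set.range g') 0 := by
    refine hE (Set.range g') (Set.range_nonempty g') ?_ ⟨?_, ?_⟩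
    · rintro _ ⟨m, rfl⟩ _ ⟨n, rfl⟩
      exact ⟨g' (max m n), ⟨_, rfl⟩, hanti _ _ (le_max_left m n), hanti _ _ (le_max_right m n)⟩
    · rintro _ ⟨n, rfl⟩ x hx
      exact hg0 n x hx
    · intro h hh x hx
      have hle : ∀ n, h x ≤ ∑' j, q (j + n) x := fun n => by
        rw [← hg n x hx]; exact hh ⟨n, rfl⟩ x hx
      exact ge_of_tendsto' (tendsto_sum_nat_add fun j => q j x) hle
  -- `C` itself is only known to be nonnegative, so `C + 1` serves as divisor.
  have hC : 0 < C + 1 := by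
    have := (norm_nonneg _).trans (hyC 0)
    linarith
  have hlow : c / (C + 1) ≤ 0 := by
    refine hglb.2 ?_
    rintro _ ⟨_, ⟨n, rfl⟩, rfl⟩
    rw [div_le_iff₀ hC]
    calc c ≤ g n (y n) := hgc n
      _ ≤ ‖g n‖ * ‖y n‖ := StrongDual.apply_le_norm_mul _ _
      _ ≤ ‖g n‖ * (C + 1) := mul_le_mul_of_nonneg_left ((hyC n).trans (by linarith))
        (norm_nonneg _)
  exact absurd (div_pos hc hC) hlow.not_gt

/-- If the dual norm is order continuous, bounded `uaw`-null sequences are weakly null. -/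
theorem HasOrderContinuousNorm.weaklyTendsto_of_uawTendsto [CompleteSpace E] [IsOrderedModule ℝ E]
    [HasSolidNorm E] (hE : HasOrderContinuousNorm (LatticeDual E)) {x : ℕ → E}
    (hb : Bornology.IsBounded (Set.range x)) (hx : UAWTendsto x atTop 0) :
    WeaklyTendsto x atTop 0 := by
  rw [weaklyTendsto_iff]
  intro f
  rw [map_zero]
  have key : ∀ F : StrongDual ℝ E, (∀ x, 0 ≤ x → 0 ≤ F x) →
      Tendsto (fun n => F (x n)) atTop (𝓝 0) := by
    intro F hF
    refine squeeze_zero_norm (a := fun n => F |x n|)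
      (fun n => StrongDual.abs_apply_le_of_nonneg hF (x n)) ?_
    obtain ⟨C, hC⟩ := hb.exists_norm_le
    rw [Metric.tendsto_atTop]
    by_contra! hcon
    obtain ⟨c, hc, hfreq⟩ := hcon
    -- Since `(|x n| - w)⁺ = |x n| - |x n| ⊓ w` and `F (|x n| ⊓ w)` tends to `0`, half of `c`
    -- survives for some `n`.
    obtain ⟨y, hy, hyC, hd, hFy⟩ := exists_disjoint_sequence hF (C := C) (half_pos hc) (by
      intro w hw
      have hlim := (weaklyTendsto_iff _ _ _).1 (hx w hw) F
      rw [map_zero] at hlim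
      obtain ⟨N, hN⟩ := eventually_atTop.1 (hlim.eventually_le_const (half_pos hc))
      obtain ⟨n, hn, hcn⟩ := hfreq N
      refine ⟨|x n|, abs_nonneg _, by rw [norm_abs_eq_norm]; exact hC _ ⟨n, rfl⟩, ?_⟩
      have h1 := hN n hn
      rw [sub_zero] at h1
      rw [Real.dist_eq, sub_zero, abs_of_nonneg (hF _ (abs_nonneg _))] at hcn
      rw [posPart_sub_eq_sub_inf, map_sub]
      linarith)
    exact hE.not_forall_le_of_disjoint hF hy hyC hd (half_pos (half_pos hc)) hFy
  obtain ⟨F, G, hF, hG, rfl⟩ := StrongDual.exists_nonneg_sub_nonneg f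
  simpa using (key F hF).sub (key G hG)

/-! ### From disjoint sequences back to order continuity -/

/-- A positive functional nearly attains its norm at a positive element of the unit ball. -/
theorem StrongDual.exists_nonneg_lt_apply [HasSolidNorm E] {f : StrongDual ℝ E}
    (hf : ∀ x, 0 ≤ x → 0 ≤ f x) {r : ℝ} (hr : r < ‖f‖) :
    ∃ x, 0 ≤ x ∧ ‖x‖ ≤ 1 ∧ r < f x := by
  obtain ⟨x, hx, hrx⟩ := f.exists_lt_apply_of_lt_opNorm hr
  exact ⟨|x|, abs_nonneg x, by rw [norm_abs_eq_norm]; exact hx.le,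
    hrx.trans_le (abs_apply_le_of_nonneg hf x)⟩

/-- A downward directed set of functionals with infimum `0` has pointwise infimum `0` on the
positive cone. -/
theorem LatticeDual.exists_apply_lt_of_isGLB_zero [HasSolidNorm E] {D : Set (LatticeDual E)}
    (hne : D.Nonempty) (hdir : DirectedOn (· ≥ ·) D) (hD : IsGLB D 0) {w : E} (hw : 0 ≤ w)
    {r : ℝ} (hr : 0 < r) : ∃ f ∈ D, f w < r := by
  have hpos : ∀ f ∈ D, ∀ x, 0 ≤ x → 0 ≤ f x := fun f hf x hx => hD.1 hf x hx
  let S : E → Set ℝ := fun x => (fun f : LatticeDual E => f x) '' D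
  have hSne : ∀ x, (S x).Nonempty := fun x => hne.image _
  have hbdd : ∀ x, 0 ≤ x → BddBelow (S x) := fun x hx => ⟨0, by
    rintro _ ⟨f, hf, rfl⟩; exact hpos f hf x hx⟩
  obtain ⟨f₀, hf₀⟩ := hne
  -- Directedness makes the pointwise infimum additive, so it extends to a lower bound of `D` in the
  -- dual, hence is at most `0`.
  obtain ⟨g, hg⟩ := exists_strongDual_eq_on_nonneg (fun x => sInf (S x)) ‖f₀‖ (by
      intro x y hx hy
      apply le_antisymm
      · rw [← sub_le_iff_le_add]
        refine le_csInf (hSne x) ?_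
        rintro _ ⟨f₁, hf₁, rfl⟩
        rw [sub_le_comm]
        refine le_csInf (hSne y) ?_
        rintro _ ⟨f₂, hf₂, rfl⟩
        obtain ⟨f, hf, h₁, h₂⟩ := hdir f₁ hf₁ f₂ hf₂
        have h : sInf (S (x + y)) ≤ f (x + y) :=
          csInf_le (hbdd _ (add_nonneg hx hy)) ⟨f, hf, rfl⟩
        have hadd : f (x + y) = f x + f y := map_add (show StrongDual ℝ E from f) x y
        have h₁' : f x ≤ f₁ x := h₁ x hx
        have h₂' : f y ≤ f₂ y := h₂ y hy
        change sInf (S (x + y)) - f₁ x ≤ f₂ y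
        linarith
      · refine le_csInf (hSne _) ?_
        rintro _ ⟨f, hf, rfl⟩
        have hadd : f (x + y) = f x + f y := map_add (show StrongDual ℝ E from f) x y
        change _ ≤ f (x + y)
        rw [hadd]
        exact add_le_add (csInf_le (hbdd x hx) ⟨f, hf, rfl⟩) (csInf_le (hbdd y hy) ⟨f, hf, rfl⟩))
    (fun x hx => le_csInf (hSne x) (by rintro _ ⟨f, hf, rfl⟩; exact hpos f hf x hx))
    (fun x hx => (csInf_le (hbdd x hx) ⟨f₀, hf₀, rfl⟩).trans
      (StrongDual.apply_le_norm_mul f₀ x)) (norm_nonneg _)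
  have hg0 : (show LatticeDual E from g) ≤ 0 := hD.2 fun f hf x hx => by
    change g x ≤ f x
    rw [hg x hx]
    exact csInf_le (hbdd x hx) ⟨f, hf, rfl⟩
  have hgw : sInf (S w) ≤ 0 := by
    rw [← hg w hw]
    exact hg0 w hw
  obtain ⟨_, ⟨f, hf, rfl⟩, hfr⟩ := exists_lt_of_csInf_lt (hSne w) (hgw.trans_lt hr)
  exact ⟨f, hf, hfr⟩

/-- If bounded disjoint sequences of positive elements are weakly null, then the dual norm is order
continuous. -/
theorem hasOrderContinuousNorm_latticeDual_of_disjoint [CompleteSpace E] [IsOrderedModule ℝ E]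
    [HasSolidNorm E]
    (h : ∀ y : ℕ → E, (∀ n, 0 ≤ y n) → Bornology.IsBounded (Set.range y) →
      (Pairwise fun m n => y m ⊓ y n = 0) → WeaklyTendsto y atTop 0) :
    HasOrderContinuousNorm (LatticeDual E) := by
  intro D hne hdir hD
  refine ⟨by rintro _ ⟨f, -, rfl⟩; exact norm_nonneg f, fun b hb => ?_⟩
  by_contra! hb0
  have hpos : ∀ f ∈ D, ∀ x, 0 ≤ x → 0 ≤ f x := fun f hf x hx => hD.1 hf x hx
  obtain ⟨f₀, hf₀⟩ := hne
  let F : StrongDual ℝ E := f₀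
  have hF : ∀ x, 0 ≤ x → 0 ≤ F x := hpos f₀ hf₀
  -- Some `f ≤ F` in `D` has `f w < b / 4`, while its norm gives `x` in the unit ball with `f x > b
  -- / 2`; so `F (x - w)⁺ ≥ f (x - w) > b / 4`.
  obtain ⟨y, hy, hyC, hd, hFy⟩ := exists_disjoint_sequence hF (C := 1) (c := b / 4)
    (by linarith) (by
      intro w hw
      obtain ⟨f₁, hf₁, hf₁w⟩ := LatticeDual.exists_apply_lt_of_isGLB_zero ⟨f₀, hf₀⟩ hdir hD hw
        (r := b / 4) (by linarith)
      obtain ⟨f, hf, hff₀, hff₁⟩ := hdir f₀ hf₀ f₁ hf₁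
      let f' : StrongDual ℝ E := f
      have hf' : ∀ x, 0 ≤ x → 0 ≤ f' x := hpos f hf
      have hfb : b ≤ ‖f'‖ := hb ⟨f, hf, rfl⟩
      obtain ⟨x, hx, hx1, hbx⟩ := StrongDual.exists_nonneg_lt_apply hf' (r := b / 2)
        (by linarith)
      refine ⟨x, hx, hx1, ?_⟩
      have h1 : f' (x - w)⁺ ≤ F (x - w)⁺ := hff₀ _ (posPart_nonneg _)
      have h2 : f' (x - w) ≤ f' (x - w)⁺ := StrongDual.mono_of_nonneg hf' (le_posPart _)
      have h3 : f' w ≤ f₁ w := hff₁ w hw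
      rw [map_sub] at h2
      linarith)
  have hlim := (weaklyTendsto_iff _ _ _).1 (h y hy
    (isBounded_iff_forall_norm_le.2 ⟨1, by rintro _ ⟨n, rfl⟩; exact hyC n⟩) hd) F
  rw [map_zero] at hlim
  have := ge_of_tendsto' hlim hFy
  linarith

end BanachLattice

theorem theorem2021 (E : Type*) [NormedAddCommGroup E] [NormedSpace ℝ E] [CompleteSpace E]
    [Lattice E] [IsOrderedAddMonoid E] [IsOrderedModule ℝ E] [HasSolidNorm E] :
    HasOrderContinuousNorm (LatticeDual E) ↔
      ∀ T : E →L[ℝ] lp (fun _ : ℕ => ℝ) ∞, IsUnboundedContinuous T := by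
  constructor
  · intro hE T x hb hx
    have hw := (weaklyTendsto_iff _ _ _).1 (hE.weaklyTendsto_of_uawTendsto hb hx)
    rw [weaklyTendsto_iff]
    intro φ
    simpa using hw (φ.comp T)
  · intro h
    refine hasOrderContinuousNorm_latticeDual_of_disjoint fun y hy hb hd => ?_
    rw [weaklyTendsto_iff]
    intro f
    have hone : (1 : lp (fun _ : ℕ => ℝ) ∞) ≠ 0 := fun h0 =>
      one_ne_zero (α := ℝ) (congrArg (fun a : lp (fun _ : ℕ => ℝ) ∞ => a 0) h0)
    -- As `φ 1 = 1`, composing `φ` with the rank-one operator `f.smulRight 1` returns `f`.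
    obtain ⟨φ, hφ⟩ := SeparatingDual.exists_eq_one (R := ℝ) hone
    have hT := (weaklyTendsto_iff _ _ _).1
      (h (f.smulRight 1) y hb (uawTendsto_zero_of_pairwise_inf_eq_zero hy hd)) φ
    simpa [hφ] using hT
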